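/- For a finite group $G$, let $G_r\le \mathrm{Sym}(G)$ be the group of all right translations $x\mapsto xg$ ($g\in G$), and let $\mathrm{Hol}(G)=N_{\mathrm{Sym}(G)}(G_r)$. The $2$-closure $K^{(2)}$ of a group $K\le\mathrm{Sym}(G)$ is the largest subgroup of $\mathrm{Sym}(G)$ that has the same orbits as $K$ on $G\times G$ (with componentwise action), and $K$ is $2$-closed if $K^{(2)}=K$. A group $K$ with $G_r\le K\le \mathrm{Sym}(G)$ is called $G$-transjugate if every regular subgroup of $K$ isomorphic to $G$ is conjugate to $G_r$ in $K$. A finite group $G$ is called an $\mathrm{NCI}^{(2)}$-group if every $2$-closed group $K$ with $G_r\le K\le \mathrm{Hol}(G)$ is $G$-transjugate. Theorem. Let $p$ be an odd prime and $k\ge 1$ an integer. Then the cyclic group $C_{p^k}$ and the group $C_{p^k}\times C_p$ are $\mathrm{NCI}^{(2)}$-groups. -/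

import Mathlib

namespace NCI

open Equiv

/-- The group `G_r` of all right translations `x ↦ x * g` of `G`, as a subgroup of `Sym(G)`. -/
def rightTranslations (G : Type*) [Group G] : Subgroup (Perm G) where
  carrier := Set.range (Equiv.mulRight : G → Perm G)
  one_mem' := ⟨1, by ext x; simp⟩
  mul_mem' := by
    rintro _ _ ⟨a, rfl⟩ ⟨b, rfl⟩
    exact ⟨b * a, by ext x; simp [mul_assoc]⟩
  inv_mem' := by
    rintro _ ⟨a, rfl⟩
    exact ⟨a⁻¹, by ext x; simp⟩

/-- The holomorph of `G`: the normalizer of `G_r` in `Sym(G)`. -/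
def holomorph (G : Type*) [Group G] : Subgroup (Perm G) :=
  Subgroup.normalizer (rightTranslations G : Set (Perm G))

/-- Two permutation groups on `Ω` are `2`-equivalent if they have the same orbits in the
componentwise action on `Ω × Ω`. -/
def TwoEquivalent {Ω : Type*} (K₁ K₂ : Subgroup (Perm Ω)) : Prop :=
  ∀ a : Ω × Ω, MulAction.orbit K₁ a = MulAction.orbit K₂ a

/-- The `2`-closure of a permutation group `K`: all permutations that agree with some element of
`K` at any two given points. It is the greatest permutation group that is `2`-equivalent to `K`,
see `isGreatest_twoClosure`. -/
def twoClosure {Ω : Type*} (K : Subgroup (Perm Ω)) : Subgroup (Perm Ω) where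
  carrier := {f | ∀ x y : Ω, ∃ k ∈ K, k x = f x ∧ k y = f y}
  one_mem' := fun _ _ => ⟨1, K.one_mem, rfl, rfl⟩
  mul_mem' := by
    intro f g hf hg x y
    obtain ⟨k, hk, hkx, hky⟩ := hg x y
    obtain ⟨l, hl, hlx, hly⟩ := hf (g x) (g y)
    exact ⟨l * k, K.mul_mem hl hk, by simp [hkx, hlx], by simp [hky, hly]⟩
  inv_mem' := by
    intro f hf x y
    obtain ⟨k, hk, hkx, hky⟩ := hf (f⁻¹ x) (f⁻¹ y)
    refine ⟨k⁻¹, K.inv_mem hk, ?_, ?_⟩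
    · rw [Perm.inv_eq_iff_eq, hkx]; simp
    · rw [Perm.inv_eq_iff_eq, hky]; simp

/-- The `2`-closure of `K` is the greatest element of the `2`-equivalence class of `K`. -/
theorem isGreatest_twoClosure {Ω : Type*} (K : Subgroup (Perm Ω)) :
    IsGreatest {L : Subgroup (Perm Ω) | TwoEquivalent L K} (twoClosure K) := by
  constructor
  · rintro ⟨x, y⟩
    ext ⟨u, v⟩
    constructor
    · rintro ⟨⟨f, hf⟩, h⟩
      obtain ⟨k, hk, hkx, hky⟩ := hf x y
      simp only [Subgroup.mk_smul, Prod.smul_mk, Perm.smul_def, Prod.mk.injEq] at h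
      exact ⟨⟨k, hk⟩, by simp [Subgroup.mk_smul, hkx, hky, h.1, h.2]⟩
    · rintro ⟨⟨k, hk⟩, h⟩
      exact ⟨⟨k, fun _ _ => ⟨k, hk, rfl, rfl⟩⟩, h⟩
  · intro L hL f hf x y
    have h : (f x, f y) ∈ MulAction.orbit L (x, y) := ⟨⟨f, hf⟩, rfl⟩
    rw [hL (x, y)] at h
    obtain ⟨⟨k, hk⟩, h⟩ := h
    simp only [Subgroup.mk_smul, Prod.smul_mk, Perm.smul_def, Prod.mk.injEq] at h
    exact ⟨k, hk, h.1, h.2⟩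

/-- A permutation group is `2`-closed if it is equal to its `2`-closure. -/
def IsTwoClosed {Ω : Type*} (K : Subgroup (Perm Ω)) : Prop :=
  twoClosure K = K

/-- A permutation group `R` on `Ω` is regular: exactly one element of `R` takes `x` to `y`. -/
def IsRegular {Ω : Type*} (R : Subgroup (Perm Ω)) : Prop :=
  ∀ x y : Ω, ∃! r : R, r • x = y

/-- `R ≤ Sym(G)` is `G`-regular: it is regular and isomorphic to `G`. -/
def IsGRegular {G : Type*} [Group G] (R : Subgroup (Perm G)) : Prop :=
  IsRegular R ∧ Nonempty (R ≃* G)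

/-- `K ≤ Sym(G)` is `G`-transjugate: `G_r ≤ K`, and every `G`-regular subgroup of `K` is conjugate
in `K` to `G_r`. -/
def IsTransjugate {G : Type*} [Group G] (K : Subgroup (Perm G)) : Prop :=
  rightTranslations G ≤ K ∧
    ∀ R : Subgroup (Perm G), R ≤ K → IsGRegular R →
      ∃ k ∈ K, R.map (MulAut.conj k).toMonoidHom = rightTranslations G

/-- A finite group `G` is an `NCI⁽²⁾`-group if every `2`-closed permutation group `K` with
`G_r ≤ K ≤ Hol(G)` is `G`-transjugate. -/
def IsNCI2Group (G : Type*) [Group G] : Prop :=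
  Finite G ∧
    ∀ K : Subgroup (Perm G), rightTranslations G ≤ K → IsTwoClosed K → K ≤ holomorph G →
      IsTransjugate K

end NCI

/-!
Write `A_K` for the group of automorphisms of `G` lying in `K`; for `G_r ≤ K ≤ Hol(G)` the group
`K` is the semidirect product of `G_r` and `A_K`. The displacement of an automorphism `α` of an
abelian group is the endomorphism `x ↦ α x / x`; its kernel is the fixed subgroup of `α`, and
`α` is called a transvection when its range has order `p`.

For odd `p`, if `K` is `2`-closed then `A_K` contains no transvection of `p`-power order
(`not_isTransvection_of_isTwoClosed`). Indeed, the `⟨α⟩`-orbit of each `z` not fixed by such an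
`α` is the whole coset `z * range`, so that translating a single coset of the fixed subgroup by an
element of the range gives a permutation in the `2`-closure of `K`. It fixes `1` but is not an
automorphism, so it is not in the holomorph.

For a `2`-closed `K`, Sylow's theorem conjugates a given subgroup `R ≅ G` of `K` into a Sylow
`p`-subgroup `P ≥ G_r` of `K`. Suppose that `|A_P| ≤ p`. Then `R` and `G_r` have the same
index, at most `p`, in `P`. If `R ≠ G_r`, some element of `R` involves a nontrivial `α ∈ A_P`, and
`α` fixes every `s` whose translation is in `R` because `R` is abelian; these `s` form a subgroup
of index at most `p`, so `α` is a transvection, which is impossible. Hence `R = G_r`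
(`eq_rightTranslations_of_card_autStabilizer_le`).

It remains to bound by `p` the order of a `p`-group of automorphisms without transvections. An
automorphism of order `p` of a cyclic `p`-group, or of a group of order `p ^ 2`, is a transvection,
so here the group is trivial. For `C_{p^k} × C_p` with `2 ≤ k`, an automorphism of order `p` that
preserves the cyclic subgroup generated by `e = (1, 0)` is a transvection. So distinct elements
of the group send `⟨e⟩` to distinct subgroups. The first coordinate of the image of `e` is a unit,
hence the image of `⟨e⟩` is determined by its slope, an element of `ZMod p`
(`card_le_of_prod`).
-/

namespace NCI

open Equiv

/-! ### Displacement and transvections -/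

section Displacement

variable {G : Type*} [CommGroup G]

/-- The endomorphism `x ↦ α x / x` of an abelian group attached to an automorphism `α`. Its kernel
is the subgroup of fixed points of `α`. -/
def displacement (α : MulAut G) : G →* G :=
  α.toMonoidHom / MonoidHom.id G

theorem displacement_apply (α : MulAut G) (x : G) : displacement α x = α x / x := rfl

theorem mem_ker_displacement {α : MulAut G} {x : G} :
    x ∈ (displacement α).ker ↔ α x = x := by
  rw [MonoidHom.mem_ker, displacement_apply, div_eq_one]

theorem ker_displacement_ne_top {α : MulAut G} (hα : α ≠ 1) : (displacement α).ker ≠ ⊤ := by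
  intro h
  refine hα (MulEquiv.ext fun x => ?_)
  have hx : x ∈ (displacement α).ker := by rw [h]; trivial
  exact mem_ker_displacement.1 hx

/-- The displacement of `α` has a range of order `p`; on a finite group this says that the fixed
points of `α` form a subgroup of index `p`. -/
def IsTransvection (p : ℕ) (α : MulAut G) : Prop :=
  Nat.card (displacement α).range = p

/-- In a `p`-group the index of the fixed subgroup is a power of `p`, so that an upper bound by `p`
already gives a transvection. -/
theorem isTransvection_of_card_range_le {p : ℕ} [Fact p.Prime] [Finite G]
    (hG : IsPGroup p G) {α : MulAut G} (hα : α ≠ 1)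
    (h : Nat.card (displacement α).range ≤ p) : IsTransvection p α := by
  obtain ⟨n, hn⟩ := hG.index (displacement α).ker
  have h1 : (displacement α).ker.index ≠ 1 := by
    rw [Ne, Subgroup.index_eq_one]
    exact ker_displacement_ne_top hα
  rw [Subgroup.index_ker] at hn h1
  have hp : 1 < p := (Fact.out : p.Prime).one_lt
  rw [hn] at h h1
  have hn1 : n ≤ 1 := (Nat.pow_le_pow_iff_right hp).1 (by simpa using h)
  have hn0 : n ≠ 0 := by rintro rfl; exact h1 (pow_zero p)
  rw [IsTransvection, hn, show n = 1 by omega, pow_one]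

theorem pow_apply_div_mem_range (α : MulAut G) (n : ℕ) (x : G) :
    (α ^ n) x / x ∈ (displacement α).range := by
  induction n with
  | zero => simp
  | succ n ih =>
    have h : (α ^ (n + 1)) x / x = displacement α ((α ^ n) x) * ((α ^ n) x / x) := by
      rw [displacement_apply, pow_succ', MulAut.mul_apply, div_mul_div_cancel]
    rw [h]
    exact mul_mem ⟨_, rfl⟩ ih

/-- The orbit of a point `z` moved by a transvection `α` of `p`-power order is the whole coset
`z * range`: it is contained in that coset, which has `p` elements, and its size is a power of `p`
other than `1`. -/
theorem IsTransvection.exists_mem_zpowers_apply_eq {p : ℕ} [Fact p.Prime] [Finite G]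
    {α : MulAut G} (hα : IsPGroup p (Subgroup.zpowers α)) (ht : IsTransvection p α)
    {z w : G} (hz : α z ≠ z) (hw : w ∈ (displacement α).range) :
    ∃ β ∈ Subgroup.zpowers α, β z = z * w := by
  have hp : 1 < p := (Fact.out : p.Prime).one_lt
  have : Finite (MulAut G) := Finite.of_injective _ (DFunLike.coe_injective (F := MulAut G))
  set O := MulAction.orbit (Subgroup.zpowers α) z with hO
  set T : Set G := (fun t => z * t) '' (displacement α).range with hT
  have hTc : T.ncard = p := by
    rw [hT, Set.ncard_image_of_injective _ (mul_right_injective z)]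
    exact ht
  have hsub : O ⊆ T := by
    rintro _ ⟨⟨β, hβ⟩, rfl⟩
    obtain ⟨n, rfl⟩ := (mem_powers_iff_mem_zpowers).2 hβ
    refine ⟨_, pow_apply_div_mem_range α n z, ?_⟩
    simp [Subgroup.smul_def]
  obtain ⟨n, hn⟩ := hα.card_orbit z
  have hle : O.ncard ≤ p := hTc ▸ Set.ncard_le_ncard hsub (Set.toFinite _)
  have hgt : 1 < O.ncard := by
    rw [Set.one_lt_ncard (Set.toFinite _)]
    exact ⟨α z, ⟨⟨α, Subgroup.mem_zpowers α⟩, rfl⟩, z, MulAction.mem_orbit_self z, hz⟩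
  have hOn : O.ncard = p ^ n := hn
  have hn0 : n ≠ 0 := by rintro rfl; simp [hOn] at hgt
  have heq : O = T := by
    refine Set.eq_of_subset_of_ncard_le hsub ?_ (Set.toFinite _)
    rw [hTc, hOn]
    exact Nat.le_self_pow hn0 p
  have hmem : z * w ∈ O := heq ▸ ⟨w, hw, rfl⟩
  obtain ⟨⟨β, hβ⟩, h⟩ := hmem
  exact ⟨β, hβ, h⟩

end Displacement

/-! ### Elements of the holomorph -/

section Holomorph

variable {G : Type*} [Group G]

theorem mulRight_mem_rightTranslations (g : G) : Equiv.mulRight g ∈ rightTranslations G :=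
  ⟨g, rfl⟩

theorem apply_mul_of_mem_holomorph {f : Perm G} (hf : f ∈ holomorph G) (x y : G) :
    f (x * y) = f x * (f 1)⁻¹ * f y := by
  obtain ⟨g, hg⟩ := (Subgroup.mem_normalizer_iff.1 hf (Equiv.mulRight y)).1
    (mulRight_mem_rightTranslations y)
  have h : ∀ t, f (t * y) = f t * g := fun t => by
    have := DFunLike.congr_fun hg (f t)
    simpa using this.symm
  have h1 := h 1
  rw [one_mul] at h1
  rw [h, h1, mul_assoc, inv_mul_cancel_left]

theorem exists_mulAut_mul_mulRight {f : Perm G} (hf : f ∈ holomorph G) :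
    ∃ (α : MulAut G) (g : G), f = MulAut.toPerm G α * Equiv.mulRight g := by
  let α : MulAut G :=
    { toEquiv := (Equiv.mulRight (f 1)⁻¹) * f
      map_mul' := fun x y => by
        simp [apply_mul_of_mem_holomorph hf x y, mul_assoc] }
  have hα : ∀ x, α x = f x * (f 1)⁻¹ := fun _ => rfl
  refine ⟨α, α.symm (f 1), Equiv.ext fun x => ?_⟩
  change f x = α (x * α.symm (f 1))
  rw [map_mul, MulEquiv.apply_symm_apply, hα, inv_mul_cancel_right]

/-- The group of all automorphisms of `G` that lie in `K`. For `K ≤ Hol(G)` this is the stabilizer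
of `1` in `K`. -/
def autStabilizer (K : Subgroup (Perm G)) : Subgroup (MulAut G) :=
  K.comap (MulAut.toPerm G)

theorem toPerm_injective : Function.Injective (MulAut.toPerm G) := fun _ _ h =>
  MulEquiv.ext fun x => DFunLike.congr_fun h x

theorem relIndex_rightTranslations_le [Finite G] {P : Subgroup (Perm G)}
    (h₁ : rightTranslations G ≤ P) (h₂ : P ≤ holomorph G) :
    (rightTranslations G).relIndex P ≤ Nat.card (autStabilizer P) := by
  have : Finite (MulAut G) := Finite.of_injective _ (DFunLike.coe_injective (F := MulAut G))
  rw [Subgroup.relIndex, Subgroup.index]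
  refine Nat.card_le_card_of_surjective
    (fun α : autStabilizer P =>
      (QuotientGroup.mk (⟨MulAut.toPerm G α, α.2⟩ : P) :
        P ⧸ (rightTranslations G).subgroupOf P)) ?_
  intro q
  obtain ⟨⟨f, hf⟩, rfl⟩ := QuotientGroup.mk_surjective q
  obtain ⟨α, g, rfl⟩ := exists_mulAut_mul_mulRight (h₂ hf)
  have hg := h₁ (mulRight_mem_rightTranslations g)
  refine ⟨⟨α, (P.mul_mem_cancel_right hg).1 hf⟩, QuotientGroup.eq.2 ?_⟩
  rw [Subgroup.mem_subgroupOf]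
  simpa using mulRight_mem_rightTranslations g

theorem card_rightTranslations : Nat.card (rightTranslations G) = Nat.card G :=
  (Nat.card_congr (Equiv.ofInjective (Equiv.mulRight : G → Perm G) fun a b h => by
    simpa using DFunLike.congr_fun h 1)).symm

end Holomorph

/-! ### Two-closed subgroups of the holomorph -/

section TwoClosed

variable {G : Type*} [CommGroup G]

theorem not_isTransvection_of_isTwoClosed {p : ℕ} [Fact p.Prime] (hp : Odd p) [Finite G]
    {K : Subgroup (Perm G)} (h₁ : rightTranslations G ≤ K) (hK : IsTwoClosed K)
    (h₂ : K ≤ holomorph G) {α : MulAut G} (hα : IsPGroup p (Subgroup.zpowers α))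
    (hαK : α ∈ autStabilizer K) : ¬ IsTransvection p α := by
  classical
  intro ht
  set H := (displacement α).ker with hH
  obtain ⟨x₀, hx₀⟩ : ∃ x₀, x₀ ∉ H := by
    by_contra! h
    have : H.index = 1 := Subgroup.index_eq_one.2 ((Subgroup.eq_top_iff' H).2 h)
    rw [hH, Subgroup.index_ker] at this
    exact (Fact.out : p.Prime).ne_one (ht.symm.trans this)
  set w := displacement α x₀ with hw
  have hw1 : w ≠ 1 := hx₀
  have hwp : w ^ p = 1 := by
    have := pow_card_eq_one' (x := (⟨w, x₀, rfl⟩ : (displacement α).range))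
    rw [ht] at this
    simpa [Subtype.ext_iff] using this
  -- `f` translates the coset of `x₀` modulo the fixed subgroup `H` and fixes all other points.
  let f : G → G := fun v => if v / x₀ ∈ H then v * w else v
  -- Up to translations `f` acts on each pair of points like an element of `K`.
  have key : ∀ u v, ∃ β ∈ autStabilizer K, β (u / v) = f u / f v := by
    intro u v
    by_cases huv : u / v ∈ H
    · refine ⟨1, one_mem _, ?_⟩
      have : u / x₀ ∈ H ↔ v / x₀ ∈ H := by
        rw [← div_mul_div_cancel u v x₀]
        exact H.mul_mem_cancel_left huv
      by_cases h : v / x₀ ∈ H <;> simp [f, this, h]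
    · have hr : ∃ t ∈ (displacement α).range, f u / f v = u / v * t := by
        have hwr : w ∈ (displacement α).range := ⟨x₀, rfl⟩
        by_cases hu : u / x₀ ∈ H <;> by_cases hv : v / x₀ ∈ H
        · exact ⟨1, one_mem _, by simp [f, hu, hv]⟩
        · exact ⟨w, hwr, by simp [f, hu, hv, mul_div_right_comm]⟩
        · exact ⟨w⁻¹, inv_mem hwr, by
            simp only [f, if_neg hu, if_pos hv, div_mul_eq_div_div, div_eq_mul_inv _ w]⟩
        · exact ⟨1, one_mem _, by simp [f, hu, hv]⟩
      obtain ⟨t, htr, hft⟩ := hr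
      obtain ⟨β, hβ, h⟩ := ht.exists_mem_zpowers_apply_eq hα
        (fun h => huv (mem_ker_displacement.2 h)) htr
      exact ⟨β, (Subgroup.zpowers_le.2 hαK) hβ, by rw [h, hft]⟩
  have hinj : Function.Injective f := by
    intro u v huv
    obtain ⟨β, -, h⟩ := key u v
    rw [huv, div_self', EmbeddingLike.map_eq_one_iff, div_eq_one] at h
    exact h
  let F : Perm G := Equiv.ofBijective f (Finite.injective_iff_bijective.1 hinj)
  have hF : ∀ x, F x = f x := fun _ => rfl
  have hFK : F ∈ K := by
    rw [← hK]
    intro u v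
    obtain ⟨β, hβ, h⟩ := key u v
    refine ⟨Equiv.mulRight (f v / β v) * MulAut.toPerm G β,
      K.mul_mem (h₁ (mulRight_mem_rightTranslations _)) hβ, ?_, ?_⟩
    · change β u * (f v / β v) = f u
      rw [map_div] at h
      rw [mul_div_left_comm, h, mul_div_cancel]
    · change β v * (f v / β v) = f v
      rw [mul_div_cancel]
  have hf1 : F 1 = 1 := by
    have : 1 / x₀ ∉ H := by rwa [one_div, inv_mem_iff]
    rw [hF]
    exact if_neg this
  have hx : F x₀ = x₀ * w := by simp [hF, f, one_mem]
  have hxx : F (x₀ * x₀) = x₀ * x₀ := by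
    have : x₀ * x₀ / x₀ ∉ H := by rwa [mul_div_cancel_right]
    rw [hF]
    exact if_neg this
  -- `f` fixes `1` and `x₀ * x₀`, so if it were multiplicative, `w ^ 2` would be `1`.
  have h := apply_mul_of_mem_holomorph (h₂ hFK) x₀ x₀
  rw [hxx, hx, hf1, inv_one, mul_one, mul_mul_mul_comm, left_eq_mul] at h
  rw [← pow_two] at h
  have h2 : orderOf w ∣ 2 := orderOf_dvd_of_pow_eq_one h
  have h3 : orderOf w ∣ p := orderOf_dvd_of_pow_eq_one hwp
  have h4 : orderOf w ∣ 1 := by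
    rw [← (Nat.coprime_two_left.2 hp).gcd_eq_one]
    exact Nat.dvd_gcd h2 h3
  exact hw1 (orderOf_eq_one_iff.1 (Nat.dvd_one.1 h4))

theorem mem_ker_displacement_of_commute {R : Subgroup (Perm G)}
    (hR : ∀ a ∈ R, ∀ b ∈ R, a * b = b * a)
    {α : MulAut G} {g : G} (hα : MulAut.toPerm G α * Equiv.mulRight g ∈ R) {s : G}
    (hs : Equiv.mulRight s ∈ R) : s ∈ (displacement α).ker := by
  have h := DFunLike.congr_fun (hR _ hα _ hs) 1
  change α (1 * s * g) = α (1 * g) * s at h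
  rw [one_mul, one_mul, map_mul, mul_comm (α s), mul_right_inj] at h
  exact mem_ker_displacement.2 h

theorem index_ker_displacement_le {R : Subgroup (Perm G)}
    (hR : ∀ a ∈ R, ∀ b ∈ R, a * b = b * a)
    {α : MulAut G} {g : G} (hα : MulAut.toPerm G α * Equiv.mulRight g ∈ R)
    (h : R.relIndex (rightTranslations G) ≠ 0) :
    (displacement α).ker.index ≤ R.relIndex (rightTranslations G) := by
  let τ : G →* Perm G :=
    { toFun := Equiv.mulRight
      map_one' := by ext x; simp
      map_mul' := fun a b => by ext x; simp [mul_assoc, mul_comm a b] }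
  have hτ : τ.range = rightTranslations G := SetLike.coe_injective rfl
  have hle : R.comap τ ≤ (displacement α).ker :=
    fun s hs => mem_ker_displacement_of_commute hR hα hs
  rw [← hτ, ← Subgroup.index_comap] at h ⊢
  exact Nat.le_of_dvd (Nat.pos_of_ne_zero h) (Subgroup.index_dvd_of_le hle)

/-- Here `R` and `G_r` have the same index, at most `p`, in `P`. An element of `R` outside `G_r`
would therefore involve an automorphism with fixed subgroup of index at most `p`. -/
theorem eq_rightTranslations_of_card_autStabilizer_le {p : ℕ} [Fact p.Prime] [Finite G]
    (hG : IsPGroup p G) {P : Subgroup (Perm G)} (h₁ : rightTranslations G ≤ P)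
    (h₂ : P ≤ holomorph G) (hA : Nat.card (autStabilizer P) ≤ p)
    (ht : ∀ α ∈ autStabilizer P, ¬ IsTransvection p α)
    {R : Subgroup (Perm G)} (hRP : R ≤ P) (hR : ∀ a ∈ R, ∀ b ∈ R, a * b = b * a)
    (hc : Nat.card R = Nat.card G) : R = rightTranslations G := by
  by_contra hne
  have hnle : ¬ R ≤ rightTranslations G := fun hle =>
    hne (Subgroup.eq_of_le_of_card_ge hle (by rw [card_rightTranslations, hc]))
  obtain ⟨r, hrR, hr⟩ := SetLike.not_le_iff_exists.1 hnle
  obtain ⟨α, g, rfl⟩ := exists_mulAut_mul_mulRight (h₂ (hRP hrR))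
  have hαP : α ∈ autStabilizer P :=
    (P.mul_mem_cancel_right (h₁ (mulRight_mem_rightTranslations g))).1 (hRP hrR)
  have hα1 : α ≠ 1 := by
    rintro rfl
    rw [map_one, one_mul] at hr
    exact hr (mulRight_mem_rightTranslations g)
  have hcard : ∀ Q : Subgroup (Perm G), Q ≤ P → Nat.card Q * Q.relIndex P = Nat.card P :=
    fun Q hQ => by
      rw [← Subgroup.relIndex_bot_left, ← Subgroup.relIndex_bot_left,
        Subgroup.relIndex_mul_relIndex _ _ _ bot_le hQ]
  have hpos : 0 < Nat.card G := Nat.card_pos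
  have heq : R.relIndex P = (rightTranslations G).relIndex P := by
    have e := (hcard R hRP).trans (hcard _ h₁).symm
    rw [hc, card_rightTranslations] at e
    exact Nat.eq_of_mul_eq_mul_left hpos e
  have h0 : R.relIndex P ≠ 0 := Subgroup.index_ne_zero_of_finite
  have hle : R.relIndex (rightTranslations G) ≤ p :=
    (Subgroup.relIndex_le_of_le_right h₁ h0).trans
      (heq.trans_le ((relIndex_rightTranslations_le h₁ h₂).trans hA))
  refine ht α hαP (isTransvection_of_card_range_le hG hα1 ?_)
  rw [← Subgroup.index_ker]
  exact (index_ker_displacement_le hR hrR Subgroup.index_ne_zero_of_finite).trans hle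

/-- The reduction, by Sylow's theorem, to a bound on transvection-free `p`-groups of
automorphisms. -/
theorem isNCI2Group_of_card_le {p : ℕ} [Fact p.Prime] (hp : Odd p) [Finite G]
    (hG : IsPGroup p G)
    (h : ∀ A : Subgroup (MulAut G), IsPGroup p A → (∀ α ∈ A, ¬ IsTransvection p α) →
      Nat.card A ≤ p) :
    IsNCI2Group G := by
  refine ⟨inferInstance, fun K h₁ hK h₂ => ⟨h₁, fun R hR ⟨_, ⟨e⟩⟩ => ?_⟩⟩
  obtain ⟨n, hn⟩ := IsPGroup.iff_card.1 hG
  have hcR : Nat.card R = Nat.card G := Nat.card_congr e.toEquiv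
  have hpT : IsPGroup p ((rightTranslations G).subgroupOf K) :=
    (IsPGroup.of_card (card_rightTranslations.trans hn)).comap_of_injective K.subtype
      K.subtype_injective
  have hpR : IsPGroup p (R.subgroupOf K) :=
    (IsPGroup.of_card (hcR.trans hn)).comap_of_injective K.subtype K.subtype_injective
  obtain ⟨P, hP⟩ := hpT.exists_le_sylow
  obtain ⟨Q, hQ⟩ := hpR.exists_le_sylow
  obtain ⟨k, hk⟩ := MulAction.exists_smul_eq K Q P
  set P' : Subgroup (Perm G) := (P : Subgroup K).map K.subtype with hP'
  have hP'K : P' ≤ K := Subgroup.map_subtype_le _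
  have hTP : rightTranslations G ≤ P' := fun t ht =>
    ⟨⟨t, h₁ ht⟩, hP (Subgroup.mem_subgroupOf.2 ht), rfl⟩
  have hpA : IsPGroup p (autStabilizer P') :=
    (P.isPGroup'.map K.subtype).comap_of_injective _ toPerm_injective
  have ht : ∀ α ∈ autStabilizer P', ¬ IsTransvection p α := fun α hα =>
    not_isTransvection_of_isTwoClosed hp h₁ hK h₂
      (hpA.to_le (Subgroup.zpowers_le.2 hα)) (hP'K hα)
  refine ⟨k, k.2, eq_rightTranslations_of_card_autStabilizer_le hG hTP (hP'K.trans h₂)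
    (h _ hpA ht) ht ?_ ?_ ?_⟩
  · rintro _ ⟨r, hr, rfl⟩
    have hmem : k * ⟨r, hR hr⟩ * k⁻¹ ∈ (P : Subgroup K) := by
      rw [← hk, Sylow.coe_subgroup_smul]
      exact Subgroup.smul_mem_pointwise_smul _ (MulAut.conj k) _
        (hQ (Subgroup.mem_subgroupOf.2 hr))
    exact ⟨_, hmem, rfl⟩
  · rintro _ ⟨a, ha, rfl⟩ _ ⟨b, hb, rfl⟩
    rw [← map_mul, ← map_mul]
    have : (⟨a, ha⟩ * ⟨b, hb⟩ : R) = ⟨b, hb⟩ * ⟨a, ha⟩ := e.injective (by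
      rw [map_mul, map_mul, mul_comm])
    exact congrArg _ (congrArg Subtype.val this)
  · rw [← hcR]
    exact (Nat.card_congr
      (R.equivMapOfInjective _ (MulAut.conj (k : Perm G)).injective).toEquiv).symm

end TwoClosed

/-! ### Automorphisms of order `p` -/

section OrderP

theorem exists_pow_eq_one_of_ne_one {H : Type*} [Group H] {p : ℕ} [Fact p.Prime]
    {γ : H} (hγ : IsPGroup p (Subgroup.zpowers γ)) (h1 : γ ≠ 1) :
    ∃ n : ℕ, (γ ^ n) ^ p = 1 ∧ γ ^ n ≠ 1 := by
  obtain ⟨j, hj⟩ := IsPGroup.iff_orderOf.1 hγ ⟨γ, Subgroup.mem_zpowers γ⟩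
  rw [Subgroup.orderOf_mk] at hj
  cases j with
  | zero => exact absurd (orderOf_eq_one_iff.1 (hj.trans (pow_zero p))) h1
  | succ j =>
    refine ⟨p ^ j, ?_, ?_⟩
    · rw [← pow_mul, ← pow_succ, ← hj, pow_orderOf_eq_one]
    · have hp : p.Prime := Fact.out
      exact pow_ne_one_of_lt_orderOf (pow_ne_zero j hp.ne_zero)
        (hj ▸ Nat.pow_lt_pow_right hp.one_lt j.lt_succ_self)

variable {G : Type*} [CommGroup G]

theorem pow_apply_eq_zpow {e : G} {β : MulAut G} {a : ℤ} (h : β e = e ^ a) (n : ℕ) :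
    (β ^ n) e = e ^ a ^ n := by
  induction n with
  | zero => simp
  | succ n ih => rw [pow_succ', MulAut.mul_apply, ih, map_zpow, h, ← zpow_mul, ← pow_succ']

/-- By Fermat's little theorem `p ∣ a - 1`, and lifting the exponent gives the claim. -/
theorem pow_dvd_mul_sub_one {p : ℕ} (hp : p.Prime) (hodd : Odd p) {k : ℕ} {a : ℤ}
    (h : (p : ℤ) ^ k ∣ a ^ p - 1) : (p : ℤ) ^ k ∣ p * (a - 1) := by
  rcases k.eq_zero_or_pos with rfl | hk
  · simp
  have : Fact p.Prime := ⟨hp⟩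
  have hpa : (p : ℤ) ∣ a - 1 := by
    have h1 : (p : ℤ) ∣ a ^ p - 1 := (dvd_pow_self _ hk.ne').trans h
    rw [← ZMod.intCast_zmod_eq_zero_iff_dvd] at h1 ⊢
    simpa using h1
  have hpa' : ¬ (p : ℤ) ∣ a := fun h => by
    have h1 := (dvd_sub_right h).1 hpa
    exact (Nat.prime_iff_prime_int.1 hp).not_dvd_one h1
  have hlte := Int.emultiplicity_pow_sub_pow hp hodd hpa hpa' p
  rw [one_pow] at hlte
  rw [pow_dvd_iff_le_emultiplicity] at h ⊢
  rw [emultiplicity_mul (Nat.prime_iff_prime_int.1 hp), add_comm, Int.natCast_emultiplicity]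
  exact hlte ▸ h

/-- If `β` has order dividing `p` and acts on the cyclic group `⟨e⟩` as the power map by `a`, then
`a ^ p` is `1` modulo the order of `e`, and therefore `e ^ (a - 1)` has order dividing `p`. -/
theorem displacement_pow_eq_one {p : ℕ} (hp : p.Prime) (hodd : Odd p) {k : ℕ} {e : G}
    (he : orderOf e = p ^ k) {β : MulAut G} (hβ : β ^ p = 1)
    (h : β e ∈ Subgroup.zpowers e) : displacement β e ^ p = 1 := by
  obtain ⟨a, ha : e ^ a = β e⟩ := h
  have h1 : e ^ (a ^ p - 1) = 1 := by
    rw [zpow_sub, ← pow_apply_eq_zpow ha.symm, hβ]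
    simp
  rw [← orderOf_dvd_iff_zpow_eq_one, he] at h1
  have h2 := pow_dvd_mul_sub_one hp hodd (by exact_mod_cast h1)
  rw [displacement_apply, ← ha, div_eq_mul_inv, ← zpow_sub_one, ← zpow_natCast, ← zpow_mul,
    ← orderOf_dvd_iff_zpow_eq_one, he, mul_comm]
  exact_mod_cast h2

/-- The hypotheses make the range of the displacement of `β` a cyclic group of exponent dividing
`p`. -/
theorem isTransvection_of_apply_mem_zpowers {p : ℕ} [Fact p.Prime] (hodd : Odd p) [Finite G]
    (hG : IsPGroup p G) {e : G} {β : MulAut G} (hβ : β ^ p = 1) (hβ1 : β ≠ 1)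
    (h : ∀ x, displacement β x ∈ Subgroup.zpowers e)
    (hG' : ∀ x : G, ∃ y ∈ Subgroup.zpowers e, (x / y) ^ p = 1) :
    IsTransvection p β := by
  have hp : p.Prime := Fact.out
  refine isTransvection_of_card_range_le hG hβ1 ?_
  have hle : (displacement β).range ≤ Subgroup.zpowers e := by
    rintro _ ⟨x, rfl⟩; exact h x
  have hcyc : IsCyclic (displacement β).range :=
    isCyclic_of_injective _ (Subgroup.inclusion_injective hle)
  obtain ⟨k, hk⟩ := IsPGroup.iff_orderOf.1 hG e
  have hβe : β e ∈ Subgroup.zpowers e := by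
    have := mul_mem (h e) (Subgroup.mem_zpowers e)
    rwa [displacement_apply, div_mul_cancel] at this
  have he := displacement_pow_eq_one hp hodd hk hβ hβe
  refine Nat.le_of_dvd hp.pos ?_
  rw [← IsCyclic.exponent_eq_card]
  refine Monoid.exponent_dvd_of_forall_pow_eq_one ?_
  rintro ⟨_, x, rfl⟩
  refine Subtype.ext ?_
  obtain ⟨_, ⟨n, rfl⟩, hy⟩ := hG' x
  change displacement β x ^ p = 1
  have hx : x = x / e ^ n * e ^ n := (div_mul_cancel _ _).symm
  rw [hx, map_mul, mul_pow, ← map_pow, hy, map_one, one_mul, map_zpow, ← zpow_natCast,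
    ← zpow_mul, mul_comm n, zpow_mul, zpow_natCast, he, one_zpow]

/-- The number of fixed points of `β` is divisible by `p`, and it is positive because `1` is
fixed. -/
theorem isTransvection_of_card_eq_sq {p : ℕ} [Fact p.Prime] (hG : Nat.card G = p ^ 2)
    {β : MulAut G} (hβ : IsPGroup p (Subgroup.zpowers β)) (hβ1 : β ≠ 1) :
    IsTransvection p β := by
  have hp : p.Prime := Fact.out
  have : Finite G := Nat.finite_of_card_ne_zero (by rw [hG]; exact pow_ne_zero 2 hp.ne_zero)
  refine isTransvection_of_card_range_le (IsPGroup.of_card hG) hβ1 ?_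
  have hfix : MulAction.fixedPoints (Subgroup.zpowers β) G ⊆ (displacement β).ker :=
    fun x hx => mem_ker_displacement.2 (hx ⟨β, Subgroup.mem_zpowers β⟩)
  have hmod := hβ.card_modEq_card_fixedPoints G
  have hdvd : p ∣ Nat.card (MulAction.fixedPoints (Subgroup.zpowers β) G) :=
    (Nat.modEq_zero_iff_dvd).1
      (hmod.symm.trans ((Nat.modEq_zero_iff_dvd).2 (hG ▸ dvd_pow_self p two_ne_zero)))
  have h1 : (1 : G) ∈ MulAction.fixedPoints (Subgroup.zpowers β) G := fun γ => by
    simp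
  have hpos : 0 < Nat.card (MulAction.fixedPoints (Subgroup.zpowers β) G) :=
    have : Nonempty (MulAction.fixedPoints (Subgroup.zpowers β) G) := ⟨⟨1, h1⟩⟩
    Nat.card_pos
  have hle : p ≤ Nat.card (displacement β).ker :=
    (Nat.le_of_dvd hpos hdvd).trans (Nat.card_mono (Set.toFinite _) hfix)
  have hmul := (displacement β).ker.card_mul_index
  rw [Subgroup.index_ker, hG, pow_two] at hmul
  refine Nat.le_of_mul_le_mul_left ?_ hp.pos
  rw [← hmul]
  exact Nat.mul_le_mul_right _ hle

theorem card_le_of_forall_pow_eq_one_isTransvection {p : ℕ} [Fact p.Prime]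
    (h : ∀ β : MulAut G, β ^ p = 1 → β ≠ 1 → IsTransvection p β)
    {A : Subgroup (MulAut G)} (hA : IsPGroup p A) (ht : ∀ α ∈ A, ¬ IsTransvection p α) :
    Nat.card A ≤ p := by
  have hbot : A = ⊥ := by
    refine (Subgroup.eq_bot_iff_forall A).2 fun γ hγ => ?_
    by_contra h1
    obtain ⟨n, hn, hn1⟩ :=
      exists_pow_eq_one_of_ne_one (hA.to_le (Subgroup.zpowers_le.2 hγ)) h1
    exact ht _ (A.pow_mem hγ n) (h _ hn hn1)
  rw [hbot, Subgroup.card_bot]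
  exact (Fact.out : p.Prime).one_le

theorem card_le_of_isCyclic {p : ℕ} [Fact p.Prime] (hodd : Odd p) [Finite G] [IsCyclic G]
    (hG : IsPGroup p G)
    {A : Subgroup (MulAut G)} (hA : IsPGroup p A) (ht : ∀ α ∈ A, ¬ IsTransvection p α) :
    Nat.card A ≤ p := by
  obtain ⟨e, he⟩ := IsCyclic.exists_generator (α := G)
  exact card_le_of_forall_pow_eq_one_isTransvection (fun β hβ hβ1 =>
    isTransvection_of_apply_mem_zpowers hodd hG hβ hβ1 (fun x => he _)
      fun x => ⟨x, he x, by simp⟩) hA ht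

end OrderP

/-! ### The group `C_{p^k} × C_p` -/

section Product

variable {M D : Type*} [CommGroup M] [CommGroup D]

/-- If `β` maps `M × 1` to itself, it induces an endomorphism of the cyclic group `D` of exponent
dividing `p`. This is a power map, whose exponent `m` satisfies `m ≡ m ^ p` modulo `p`; since the
`p`-th iterate is trivial, so is the map itself. -/
theorem apply_snd_eq {p : ℕ} [Fact p.Prime] [IsCyclic D] (hD : ∀ y : D, y ^ p = 1)
    {β : MulAut (M × D)} (hβ : β ^ p = 1) (h : ∀ x : M, (β (x, 1)).2 = 1) (x : M × D) :
    (β x).2 = x.2 := by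
  let ψ : D →* D :=
    (MonoidHom.snd M D).comp (β.toMonoidHom.comp (MonoidHom.inr M D))
  have hψ : ∀ x : M × D, (β x).2 = ψ x.2 := fun x => by
    have hx : x = (x.1, 1) * (1, x.2) := by simp
    conv_lhs => rw [hx, map_mul, Prod.snd_mul, h, one_mul]
    rfl
  obtain ⟨m, hm⟩ := ψ.map_cyclic
  have hpow : ∀ n : ℕ, ((β ^ n) x).2 = x.2 ^ m ^ n := fun n => by
    induction n with
    | zero => simp
    | succ n ih => rw [pow_succ', MulAut.mul_apply, hψ, ih, hm, ← zpow_mul, ← pow_succ]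
  have hp := hpow p
  rw [hβ, MulAut.one_apply] at hp
  rw [hψ, hm]
  conv_rhs => rw [hp]
  rw [zpow_eq_zpow_iff_modEq]
  have hmod : m ≡ m ^ p [ZMOD p] := by
    rw [← ZMod.intCast_eq_intCast_iff]
    simp
  exact hmod.of_dvd (Int.natCast_dvd_natCast.2 (orderOf_dvd_of_pow_eq_one (hD _)))

variable {p k : ℕ}

theorem mem_zpowers_ofAdd_one [NeZero p]
    {x : Multiplicative (ZMod (p ^ k)) × Multiplicative (ZMod p)} (hx : x.2 = 1) :
    x ∈ Subgroup.zpowers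
      ((Multiplicative.ofAdd 1, 1) : Multiplicative (ZMod (p ^ k)) × Multiplicative (ZMod p)) := by
  refine ⟨(x.1.toAdd.val : ℤ), Prod.ext ?_ ?_⟩
  · apply Multiplicative.toAdd.injective
    simp
  · simp [hx]

theorem snd_eq_one_of_mem_zpowers {M D : Type*} [Group M] [Group D] {m : M} {x : M × D}
    (hx : x ∈ Subgroup.zpowers (m, (1 : D))) : x.2 = 1 := by
  obtain ⟨n, rfl⟩ := hx
  simp

/-- Otherwise the image of `(1, 0)` would have order at most `p ^ (k - 1)`. For `k = 1` this fails:
the two factors can be exchanged. -/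
theorem isUnit_fst_apply [Fact p.Prime] (hk : 2 ≤ k)
    (α : MulAut (Multiplicative (ZMod (p ^ k)) × Multiplicative (ZMod p))) :
    IsUnit (α (Multiplicative.ofAdd 1, 1)).1.toAdd := by
  have hp : p.Prime := Fact.out
  set e : Multiplicative (ZMod (p ^ k)) × Multiplicative (ZMod p) :=
    (Multiplicative.ofAdd 1, 1)
  by_contra hu
  obtain ⟨x, hx⟩ : ∃ x : ℕ, (x : ZMod (p ^ k)) = (α e).1.toAdd :=
    ⟨_, ZMod.natCast_zmod_val _⟩
  rw [← hx, ZMod.isUnit_iff_coprime, Nat.coprime_pow_right_iff (by omega), Nat.coprime_comm,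
    hp.coprime_iff_not_dvd, not_not] at hu
  have hαe : α e ^ p ^ (k - 1) = 1 := by
    refine Prod.ext ?_ ?_
    · apply Multiplicative.toAdd.injective
      rw [Prod.pow_fst, toAdd_pow, ← hx, nsmul_eq_mul, ← Nat.cast_mul, Prod.fst_one, toAdd_one,
        ZMod.natCast_eq_zero_iff]
      calc p ^ k = p ^ (k - 1) * p := by rw [← pow_succ, Nat.sub_add_cancel (by omega)]
        _ ∣ p ^ (k - 1) * x := Nat.mul_dvd_mul_left _ hu
    · apply Multiplicative.toAdd.injective
      rw [Prod.pow_snd, toAdd_pow, nsmul_eq_mul, Nat.cast_pow, CharP.cast_eq_zero,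
        zero_pow (by omega), zero_mul]
      rfl
  rw [← map_pow, EmbeddingLike.map_eq_one_iff] at hαe
  have h1 := congrArg (fun x => Multiplicative.toAdd x.1) hαe
  simp only [e, Prod.pow_fst, toAdd_pow, toAdd_ofAdd, nsmul_eq_mul, mul_one, Prod.fst_one,
    toAdd_one, ZMod.natCast_eq_zero_iff] at h1
  have := (Nat.pow_dvd_pow_iff_le_right hp.one_lt).1 h1
  omega

theorem isTransvection_of_apply_ofAdd_one_mem_zpowers [Fact p.Prime] (hodd : Odd p)
    {β : MulAut (Multiplicative (ZMod (p ^ k)) × Multiplicative (ZMod p))}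
    (hβ : β ^ p = 1) (hβ1 : β ≠ 1)
    (h : β (Multiplicative.ofAdd 1, 1) ∈ Subgroup.zpowers (Multiplicative.ofAdd 1, 1)) :
    IsTransvection p β := by
  have hG : IsPGroup p (Multiplicative (ZMod (p ^ k)) × Multiplicative (ZMod p)) :=
    IsPGroup.of_card (n := k + 1) (by
      rw [Nat.card_prod]
      simp [pow_succ])
  have hD : ∀ y : Multiplicative (ZMod p), y ^ p = 1 := fun y => by
    apply Multiplicative.toAdd.injective
    simp
  refine isTransvection_of_apply_mem_zpowers hodd hG hβ hβ1 (e := (Multiplicative.ofAdd 1, 1))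
    (fun x => mem_zpowers_ofAdd_one ?_) fun x => ?_
  · rw [displacement_apply, Prod.snd_div, apply_snd_eq hD hβ (fun x => ?_), div_self']
    obtain ⟨n, hn⟩ := mem_zpowers_ofAdd_one (p := p) (k := k) (x := (x, 1)) rfl
    refine snd_eq_one_of_mem_zpowers (m := Multiplicative.ofAdd 1) ?_
    rw [← hn]
    change β (_ ^ n) ∈ _
    rw [map_zpow]
    exact Subgroup.zpow_mem _ h n
  · refine ⟨(x.1, 1), mem_zpowers_ofAdd_one rfl, Prod.ext ?_ ?_⟩
    · simp
    · simpa using hD x.2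

/-- The slope of the image of `(1, 0)` embeds the group into `ZMod p`: if `α` and `β` have the same
slope, then `α⁻¹ * β` preserves the cyclic subgroup generated by `(1, 0)`, and if nontrivial it has
a power that is a transvection. -/
theorem card_le_of_prod [Fact p.Prime] (hodd : Odd p) (hk : 2 ≤ k)
    {A : Subgroup (MulAut (Multiplicative (ZMod (p ^ k)) × Multiplicative (ZMod p)))}
    (hA : IsPGroup p A) (ht : ∀ α ∈ A, ¬ IsTransvection p α) :
    Nat.card A ≤ p := by
  have hp : p.Prime := Fact.out
  set e : Multiplicative (ZMod (p ^ k)) × Multiplicative (ZMod p) :=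
    (Multiplicative.ofAdd 1, 1) with he
  let π : ZMod (p ^ k) →+* ZMod p := ZMod.castHom (dvd_pow_self p (by omega)) (ZMod p)
  let slope : A → ZMod p := fun α => (α.1 e).2.toAdd / π (α.1 e).1.toAdd
  suffices hinj : Function.Injective slope by
    simpa using Nat.card_le_card_of_injective slope hinj
  rintro ⟨α, hα⟩ ⟨β, hβ⟩ hs
  change (α e).2.toAdd / π (α e).1.toAdd = (β e).2.toAdd / π (β e).1.toAdd at hs
  have hu := isUnit_fst_apply hk α
  have hv := (isUnit_fst_apply hk β).map π
  rw [div_eq_div_iff (hu.map π).ne_zero hv.ne_zero] at hs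
  obtain ⟨n, hn⟩ : ∃ n : ℕ, (n : ZMod (p ^ k)) * (α e).1.toAdd = (β e).1.toAdd := by
    obtain ⟨u, hu⟩ := hu
    refine ⟨((β e).1.toAdd * ↑u⁻¹ : ZMod (p ^ k)).val, ?_⟩
    rw [ZMod.natCast_zmod_val, ← hu, Units.inv_mul_cancel_right]
  have hβe : β e = α e ^ n := by
    refine Prod.ext ?_ ?_
    · apply Multiplicative.toAdd.injective
      rw [Prod.pow_fst, toAdd_pow, nsmul_eq_mul, hn]
    · apply Multiplicative.toAdd.injective
      rw [Prod.pow_snd, toAdd_pow, nsmul_eq_mul]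
      refine mul_right_cancel₀ (hu.map π).ne_zero ?_
      rw [← hs, ← hn, map_mul, map_natCast]
      ring
  have hγA : α⁻¹ * β ∈ A := A.mul_mem (A.inv_mem hα) hβ
  have hγe : (α⁻¹ * β) e = e ^ (n : ℤ) := by
    rw [MulAut.mul_apply, hβe, map_pow, MulAut.inv_apply_self, zpow_natCast]
  refine Subtype.ext (inv_mul_eq_one.1 ?_)
  by_contra h1
  obtain ⟨m, hm, hm1⟩ :=
    exists_pow_eq_one_of_ne_one (hA.to_le (Subgroup.zpowers_le.2 hγA)) h1
  refine ht _ (A.pow_mem hγA m)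
    (isTransvection_of_apply_ofAdd_one_mem_zpowers hodd hm hm1 ⟨(n : ℤ) ^ m, ?_⟩)
  exact (pow_apply_eq_zpow hγe m).symm

end Product
end NCI

theorem theorem1p3 (p : ℕ) (hp : p.Prime) (hp2 : Odd p) (k : ℕ) (hk : 1 ≤ k) :
    NCI.IsNCI2Group (Multiplicative (ZMod (p ^ k))) ∧
      NCI.IsNCI2Group (Multiplicative (ZMod (p ^ k)) × Multiplicative (ZMod p)) := by
  have : Fact p.Prime := ⟨hp⟩
  have hM : Nat.card (Multiplicative (ZMod (p ^ k))) = p ^ k := by simp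
  have hMD : Nat.card (Multiplicative (ZMod (p ^ k)) × Multiplicative (ZMod p)) = p ^ (k + 1) := by
    rw [Nat.card_prod]
    simp [pow_succ]
  constructor
  · have hG := IsPGroup.of_card hM
    exact NCI.isNCI2Group_of_card_le hp2 hG fun A hA ht => NCI.card_le_of_isCyclic hp2 hG hA ht
  · refine NCI.isNCI2Group_of_card_le hp2 (IsPGroup.of_card hMD) fun A hA ht => ?_
    rcases hk.eq_or_lt with rfl | hk
    · refine NCI.card_le_of_forall_pow_eq_one_isTransvection (fun β hβ hβ1 => ?_) hA ht
      refine NCI.isTransvection_of_card_eq_sq hMD (IsPGroup.of_card_dvd_pow (n := 1) ?_) hβ1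
      rw [Nat.card_zpowers]
      exact (orderOf_dvd_of_pow_eq_one hβ).trans (dvd_pow_self p one_ne_zero)
    · exact NCI.card_le_of_prod hp2 hk hA ht
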